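/- Let $R$ be a commutative ring, let $a=(a_k)_{k\in\mathbb{Z}}$ be a doubly infinite sequence of elements of $R$, let $n\ge 0$, and let $x=(x_1,\ldots,x_n)$ be independent indeterminates over $R$. For $r\ge 0$ put $(T\mid a)^r=(T+a_1)(T+a_2)\cdots(T+a_r)$; for $\alpha\in\mathbb{N}^n$ put $A_\alpha(x\mid a)=\det\left((x_i\mid a)^{\alpha_j}\right)_{1\le i,j\le n}$, and let $\delta=(n-1,n-2,\ldots,0)$. For a partition $\lambda$ with at most $n$ nonzero parts, let $s_\lambda(x\mid a)=A_{\lambda+\delta}(x\mid a)/A_\delta(x\mid a)\in R[x_1,\ldots,x_n]$. Let $h_r(x\mid a)=s_{(r)}(x\mid a)$ for $r\ge 0$ (with $h_r(x\mid a)=0$ if $n=0$ and $r>0$), and $h_r(x\mid a)=0$ for $r<0$. For $r\in\mathbb{Z}$ let $\tau^r a$ be the sequence with $(\tau^r a)_k=a_{k+r}$. For any two partitions $\lambda$ and $\mu$, the skew factorial Schur polynomial in $n$ variables is \[ s_{\lambda/\mu}(x\mid a)=\det\left(h_{\lambda_i-\mu_j-i+j}\left(x\mid\tau^{\mu_j-j+1}a\right)\right)_{1\le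 i,j\le m}, \] where $m$ is any integer that is at least the number of nonzero parts of $\lambda$ and of $\mu$ (the determinant does not depend on the choice of $m$). Then $s_{\lambda/\mu}(x\mid a)=0$ unless $0\le\lambda'_i-\mu'_i\le n$ for all $i\ge 1$, where $\lambda'$ and $\mu'$ are the conjugate partitions of $\lambda$ and $\mu$. This holds for every such choice of $m$. -/

import Mathlib

/-!
Factorial Schur polynomials `s_λ(x|a)` and skew factorial Schur polynomials `s_{λ/μ}(x|a)`.

Partitions are Young diagrams.  Rows and columns are numbered from `0` in Mathlib, so that
`λ_i` is `lam.rowLen (i - 1)`, `λ'_i` is `lam.colLen (i - 1)`, and the length `ℓ(λ)` is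
`lam.colLen 0`.  The variables `x_1, …, x_n` are `MvPolynomial.X i` for `i : Fin n`, and
`a = (a_k)_{k ∈ ℤ}` is a doubly infinite sequence in the coefficient ring `R`.
-/

namespace FactorialSchur

open MvPolynomial

variable {R : Type*} [CommRing R]

/-- The shifted sequence `τ^r a`, with `(τ^r a)_k = a_{k+r}`. -/
def shift (r : ℤ) (a : ℤ → R) : ℤ → R := fun k => a (k + r)

/-- The factorial power `(T|a)^r = (T + a_1)(T + a_2) ⋯ (T + a_r)`, as a polynomial in `T`. -/
noncomputable def facPow (a : ℤ → R) (r : ℕ) : Polynomial R :=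
  ∏ k ∈ Finset.range r, (Polynomial.X + Polynomial.C (a ((k : ℤ) + 1)))

/-- The determinant `A_α(x|a) = det ((x_i|a)^{α_j})_{i,j ∈ [n]}`. -/
noncomputable def altDet {n : ℕ} (a : ℤ → R) (α : Fin n → ℕ) : MvPolynomial (Fin n) R :=
  Matrix.det (Matrix.of fun i j : Fin n => Polynomial.aeval (X i) (facPow a (α j)))

/-- The exponent vector `δ = (n-1, n-2, …, 1, 0)`. -/
def delta (n : ℕ) : Fin n → ℕ := fun j => n - 1 - (j : ℕ)

theorem isRegular_X_sub_X {σ : Type*} [DecidableEq σ] {i j : σ} (h : i ≠ j) :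
    IsRegular (X j - X i : MvPolynomial σ R) := by
  let f : MvPolynomial σ R →ₐ[R] MvPolynomial σ R :=
    aeval fun k => if k = j then X j + X i else X k
  let g : MvPolynomial σ R →ₐ[R] MvPolynomial σ R :=
    aeval fun k => if k = j then X j - X i else X k
  have hgf : ∀ p, g (f p) = p := by
    intro p
    have : (g.comp f) = AlgHom.id R _ := by
      ext k : 1
      by_cases hk : k = j
      · subst hk; simp [f, g, h]
      · simp [f, g, hk]
    exact DFunLike.congr_fun this p
  have hf : f (X j - X i) = X j := by simp [f, h]
  rw [← isLeftRegular_iff_isRegular]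
  intro p q hpq
  have h1 : X j * f p = X j * f q := by
    have := congrArg f hpq
    simpa [hf, map_mul] using this
  have h2 := (isRegular_X (R := R) (n := j)).left h1
  rw [← hgf p, ← hgf q, h2]

theorem isRegular_det_vandermonde (n : ℕ) :
    IsRegular (Matrix.vandermonde fun i : Fin n => (X i : MvPolynomial (Fin n) R)).det := by
  rw [Matrix.det_vandermonde]
  refine IsRegular.prod fun i _ => IsRegular.prod fun j hj => ?_
  exact isRegular_X_sub_X (ne_of_lt (Finset.mem_Ioi.1 hj))

theorem facPow_monic (a : ℤ → R) (r : ℕ) : (facPow a r).Monic :=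
  Polynomial.monic_prod_of_monic _ _ fun _ _ => Polynomial.monic_X_add_C _

theorem facPow_natDegree [Nontrivial R] (a : ℤ → R) (r : ℕ) : (facPow a r).natDegree = r := by
  rw [facPow, Polynomial.natDegree_prod_of_monic _ _ fun _ _ => Polynomial.monic_X_add_C _]
  simp

/-- `A_δ(x|a)` is, up to sign, the Vandermonde determinant. -/
theorem altDet_delta {n : ℕ} (a : ℤ → R) :
    altDet a (delta n) = (Equiv.Perm.sign (Fin.revPerm (n := n)) : MvPolynomial (Fin n) R) *
      (Matrix.vandermonde fun i : Fin n => (X i : MvPolynomial (Fin n) R)).det := by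
  nontriviality R
  rw [Matrix.det_eval_matrixOfPolynomials_eq_det_vandermonde _
    (fun j : Fin n => (facPow a (j : ℕ)).map (algebraMap R (MvPolynomial (Fin n) R)))
    (fun j => by
      rw [(facPow_monic a _).natDegree_map, facPow_natDegree])
    (fun j => (facPow_monic a _).map _), ← Matrix.det_permute', altDet]
  congr 1
  ext1 i j
  rw [Matrix.submatrix_apply, Matrix.of_apply, Matrix.of_apply, Polynomial.eval_map_algebraMap]
  simp [delta, Fin.val_rev, Nat.sub_sub, add_comm]

/-- `A_δ(x|a)` divides every `A_α(x|a)`, and the quotient is unique. -/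
theorem existsUnique_quotient {n : ℕ} (a : ℤ → R) (α : Fin n → ℕ) :
    ∃! q : MvPolynomial (Fin n) R, q * altDet a (delta n) = altDet a α := by
  nontriviality R
  have hs : ((Equiv.Perm.sign (Fin.revPerm (n := n)) : ℤ) : MvPolynomial (Fin n) R) *
      ((Equiv.Perm.sign (Fin.revPerm (n := n)) : ℤ) : MvPolynomial (Fin n) R) = 1 := by
    rw [← Int.cast_mul, ← Units.val_mul, Int.units_mul_self]; simp
  set V := Matrix.vandermonde fun i : Fin n => (X i : MvPolynomial (Fin n) R) with hV
  set P : Polynomial (MvPolynomial (Fin n) R) :=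
    ∏ i : Fin n, (Polynomial.X - Polynomial.C (X i)) with hP
  have hPm : P.Monic := Polynomial.monic_prod_of_monic _ _ fun _ _ => Polynomial.monic_X_sub_C _
  have hPd : P.natDegree = n := by
    rw [hP, Polynomial.natDegree_prod_of_monic _ _ fun _ _ => Polynomial.monic_X_sub_C _]; simp
  let f : Fin n → Polynomial (MvPolynomial (Fin n) R) :=
    fun j => (facPow a (α j)).map (algebraMap R (MvPolynomial (Fin n) R)) %ₘ P
  have hf : ∀ i j, (f j).eval (X i) = Polynomial.aeval (X i) (facPow a (α j)) := by
    intro i j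
    have h0 : P.eval (X i) = 0 := by
      rw [hP, Polynomial.eval_prod]
      exact Finset.prod_eq_zero (Finset.mem_univ i) (by simp)
    have := congrArg (Polynomial.eval (X i))
      (Polynomial.modByMonic_add_div
        ((facPow a (α j)).map (algebraMap R (MvPolynomial (Fin n) R))) P)
    rw [Polynomial.eval_add, Polynomial.eval_mul, h0, zero_mul, add_zero,
      Polynomial.eval_map_algebraMap] at this
    exact this
  have hdeg : ∀ j, (f j).natDegree < n := by
    intro j
    have hn : P ≠ 1 := by
      intro h
      rw [h, Polynomial.natDegree_one] at hPd
      have := j.pos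
      omega
    exact lt_of_lt_of_eq (Polynomial.natDegree_modByMonic_lt _ hPm hn) hPd
  have hfac : altDet a α =
      V.det * (Matrix.of fun i j : Fin n => (f j).coeff (i : ℕ)).det := by
    rw [← Matrix.det_mul, altDet]
    congr 1
    ext1 i j
    rw [Matrix.of_apply, ← hf i j, Matrix.mul_apply, Polynomial.eval_eq_sum_range' (hdeg j),
      ← Fin.sum_univ_eq_sum_range (fun k => (f j).coeff k * (X i : MvPolynomial (Fin n) R) ^ k) n]
    refine Finset.sum_congr rfl fun k _ => ?_
    rw [Matrix.of_apply, hV, Matrix.vandermonde_apply, mul_comm]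
  rw [altDet_delta]
  set s := ((Equiv.Perm.sign (Fin.revPerm (n := n)) : ℤ) : MvPolynomial (Fin n) R)
  refine ⟨s * (Matrix.of fun i j : Fin n => (f j).coeff (i : ℕ)).det, ?_, ?_⟩
  · show _ * (s * V.det) = _
    rw [hfac]
    linear_combination ((Matrix.of fun i j : Fin n => (f j).coeff (i : ℕ)).det * V.det) * hs
  · intro q hq
    change q * (s * V.det) = _ at hq
    apply (isRegular_det_vandermonde (R := R) n).right
    show q * V.det = _ * V.det
    rw [hfac] at hq
    linear_combination s * hq - q * V.det * hs

/-- The quotient `A_α(x|a) / A_δ(x|a)`, a polynomial in `x_1, …, x_n` over `R`. -/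
noncomputable def altQuotient {n : ℕ} (a : ℤ → R) (α : Fin n → ℕ) : MvPolynomial (Fin n) R :=
  (existsUnique_quotient a α).choose

theorem altQuotient_mul {n : ℕ} (a : ℤ → R) (α : Fin n → ℕ) :
    altQuotient a α * altDet a (delta n) = altDet a α :=
  (existsUnique_quotient a α).choose_spec.1

/-- The factorial Schur polynomial `s_λ(x|a) = A_{λ+δ}(x|a) / A_δ(x|a)` in `n` variables
for a partition `λ` of length at most `n`; it is `0` for longer partitions. -/
noncomputable def schur (n : ℕ) (a : ℤ → R) (lam : YoungDiagram) : MvPolynomial (Fin n) R :=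
  if lam.colLen 0 ≤ n then altQuotient a (fun j => lam.rowLen j + delta n j) else 0

/-- The one-row partition `(r)`. -/
def oneRow (r : ℕ) : YoungDiagram :=
  YoungDiagram.ofRowLens [r] (List.pairwise_singleton _ _).sortedGE

/-- The complete factorial polynomial `h_r(x|a) = s_{(r)}(x|a)`, with `h_r(x|a) = 0` for `r < 0`.
For `n = 0` and `r > 0` it is `0`. -/
noncomputable def complete (n : ℕ) (a : ℤ → R) (r : ℤ) : MvPolynomial (Fin n) R :=
  if 0 ≤ r then schur n a (oneRow r.toNat) else 0

/-- The skew factorial Schur polynomial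
`s_{λ/μ}(x|a) = det (h_{λ_i - μ_j - i + j}(x | τ^{μ_j - j + 1} a))_{i,j ∈ [m]}`,
where `m` is any integer with `ℓ(λ) ≤ m` and `ℓ(μ) ≤ m`; the value does not depend on it.
In the code `i` and `j` run from `0` to `m - 1`, so `μ_j - j + 1` becomes `μ.rowLen j - j`. -/
noncomputable def skewSchur (n : ℕ) (a : ℤ → R) (lam mu : YoungDiagram) (m : ℕ) :
    MvPolynomial (Fin n) R :=
  Matrix.det (Matrix.of fun i j : Fin m =>
    complete n (shift ((mu.rowLen j : ℤ) - (j : ℕ)) a)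
      ((lam.rowLen i : ℤ) - mu.rowLen j - (i : ℕ) + (j : ℕ)))

end FactorialSchur

namespace FactorialSchur

/-! Write P = (T - x_1)⋯(T - x_n). The polynomial h_r(x|a) is the coefficient of T^(n-1) in the
remainder of (T|a)^(r+n-1) modulo P (`complete_eq_topRemainder`). If λ'_c - μ'_c > n, then on a
large corner block of the matrix each factorial power splits, at a point independent of i and j,
into a factor depending on j times a factor depending on i. Since polynomials modulo P form a free
module of rank n, this block factors through n dimensions (`topRemainder_mul`), too few for a
nonzero determinant (`det_eq_zero_of_block_factors`). If λ'_c < μ'_c, the corresponding block is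
zero because its indices are negative. -/

/-! ### Determinants with a block of small rank -/

/-- A square matrix that factors through a smaller index type has zero determinant. -/
theorem det_mul_eq_zero_of_card_lt {S m κ : Type*} [CommRing S] [Fintype m] [DecidableEq m]
    [Fintype κ] (hκ : Fintype.card κ < Fintype.card m) (A : Matrix m κ S) (B : Matrix κ m S) :
    (A * B).det = 0 := by
  have hcard : Fintype.card m = Fintype.card (κ ⊕ Fin (Fintype.card m - Fintype.card κ)) := by
    simp only [Fintype.card_sum, Fintype.card_fin]
    omega
  let e := Fintype.equivOfCardEq hcard
  -- Padding with zero columns and rows makes both factors square without changing the product.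
  have hAB : A * B = ((Matrix.fromCols A 0).submatrix id e) *
      ((Matrix.fromRows B 0).submatrix e id) := by
    rw [← Matrix.submatrix_mul _ _ _ _ _ e.bijective, Matrix.fromCols_mul_fromRows]
    simp
  rw [hAB, Matrix.det_mul,
    Matrix.det_eq_zero_of_column_eq_zero (e.symm (Sum.inr ⟨0, by omega⟩)) (by intro i; simp),
    zero_mul]

/-- If the block `I × J` of a square matrix factors through a type `κ` with
`|κ| + |m| < |I| + |J|`, then the determinant vanishes. -/
theorem det_eq_zero_of_block_factors {S m κ : Type*} [CommRing S] [Fintype m] [DecidableEq m]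
    [Fintype κ] (M : Matrix m m S) (I J : Finset m) (A : m → κ → S) (B : κ → m → S)
    (hcard : Fintype.card κ + Fintype.card m < I.card + J.card)
    (hM : ∀ i ∈ I, ∀ j ∈ J, M i j = ∑ s, A i s * B s j) : M.det = 0 := by
  -- The inner index has |κ| + 2|m| - |I| - |J| < |m| elements: κ accounts for the block, the
  -- complement of I for the remaining rows, and the complement of J for the remaining columns
  -- within I.
  let A' : Matrix m (κ ⊕ ({i // i ∈ Iᶜ} ⊕ {j // j ∈ Jᶜ})) S := Matrix.of fun i =>
    Sum.elim (fun s => if i ∈ I then A i s else 0)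
      (Sum.elim (fun i' => if i = i'.1 then 1 else 0) fun j' => if i ∈ I then M i j'.1 else 0)
  let B' : Matrix (κ ⊕ ({i // i ∈ Iᶜ} ⊕ {j // j ∈ Jᶜ})) m S := Matrix.of fun k j =>
    Sum.elim (fun s => if j ∈ J then B s j else 0)
      (Sum.elim (fun i' => M i'.1 j) fun j' => if j = j'.1 then 1 else 0) k
  have hAB : M = A' * B' := by
    ext i j
    have h1 := Finset.sum_coe_sort Iᶜ fun x => (if i = x then 1 else 0) * M x j
    have h2 := Finset.sum_coe_sort Jᶜ fun x =>
      (if i ∈ I then M i x else 0) * (if j = x then 1 else 0)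
    simp only [ite_mul, one_mul, zero_mul, mul_ite, mul_one, mul_zero, Finset.sum_ite_eq,
      Finset.mem_compl] at h1 h2
    simp only [Matrix.mul_apply, Fintype.sum_sum_type, A', B', Matrix.of_apply, Sum.elim_inl,
      Sum.elim_inr, ite_mul, one_mul, zero_mul, mul_ite, mul_one, mul_zero]
    rw [h1, h2]
    by_cases hi : i ∈ I <;> by_cases hj : j ∈ J <;> simp [hi, hj]
    exact hM i hi j hj
  rw [hAB]
  apply det_mul_eq_zero_of_card_lt
  simp only [Fintype.card_sum, Fintype.card_coe, Finset.card_compl]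
  have := I.card_le_univ
  have := J.card_le_univ
  omega

open MvPolynomial

section

variable {R : Type*} [CommRing R]

/-! ### Factorial powers modulo P -/

theorem facPow_add (a : ℤ → R) (r s : ℕ) :
    facPow a (r + s) = facPow a r * facPow (shift r a) s := by
  rw [facPow, Finset.prod_range_add]
  congr 1
  refine Finset.prod_congr rfl fun k _ => ?_
  simp only [shift]
  congr 3
  push_cast
  ring

theorem shift_shift {S : Type*} (r s : ℤ) (a : ℤ → S) : shift r (shift s a) = shift (r + s) a := by
  funext k
  simp only [shift]
  congr 1
  ring

/-- The polynomial `(T - x_1) ⋯ (T - x_n)`. -/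
noncomputable def rootPoly (R : Type*) [CommRing R] (n : ℕ) : Polynomial (MvPolynomial (Fin n) R) :=
  ∏ i : Fin n, (Polynomial.X - Polynomial.C (X i))

/-- The coefficient of `T^(n-1)` in the remainder of `f` modulo `(T - x_1) ⋯ (T - x_n)`. -/
noncomputable def topRemainder {n : ℕ} (f : Polynomial (MvPolynomial (Fin n) R)) :
    MvPolynomial (Fin n) R :=
  (f %ₘ rootPoly R n).coeff (n - 1)

/-- The factorial power with coefficients in `R[x_1, …, x_n]`. -/
noncomputable def liftFacPow (n : ℕ) (a : ℤ → R) (r : ℕ) : Polynomial (MvPolynomial (Fin n) R) :=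
  (facPow a r).map (algebraMap R (MvPolynomial (Fin n) R))

theorem liftFacPow_add (n : ℕ) (a : ℤ → R) (r s : ℕ) :
    liftFacPow n a (r + s) = liftFacPow n a r * liftFacPow n (shift r a) s := by
  simp only [liftFacPow, facPow_add, Polynomial.map_mul]

theorem liftFacPow_monic (n : ℕ) (a : ℤ → R) (r : ℕ) : (liftFacPow n a r).Monic :=
  (facPow_monic a r).map _

theorem liftFacPow_natDegree [Nontrivial R] (n : ℕ) (a : ℤ → R) (r : ℕ) :
    (liftFacPow n a r).natDegree = r := by
  rw [liftFacPow, (facPow_monic a r).natDegree_map, facPow_natDegree]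

theorem rootPoly_monic (n : ℕ) : (rootPoly R n).Monic :=
  Polynomial.monic_prod_of_monic _ _ fun _ _ => Polynomial.monic_X_sub_C _

theorem rootPoly_natDegree [Nontrivial R] (n : ℕ) : (rootPoly R n).natDegree = n := by
  rw [rootPoly, Polynomial.natDegree_prod_of_monic _ _ fun _ _ => Polynomial.monic_X_sub_C _]
  simp

theorem eval_modByMonic_rootPoly {n : ℕ} (f : Polynomial (MvPolynomial (Fin n) R)) (i : Fin n) :
    (f %ₘ rootPoly R n).eval (X i) = f.eval (X i) := by
  have h0 : (rootPoly R n).eval (X i) = 0 := by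
    rw [rootPoly, Polynomial.eval_prod]
    exact Finset.prod_eq_zero (Finset.mem_univ i) (by simp)
  have := congrArg (Polynomial.eval (X i)) (Polynomial.modByMonic_add_div f (rootPoly R n))
  rwa [Polynomial.eval_add, Polynomial.eval_mul, h0, zero_mul, add_zero] at this

theorem natDegree_modByMonic_rootPoly_lt [Nontrivial R] {n : ℕ} (hn : 0 < n)
    (f : Polynomial (MvPolynomial (Fin n) R)) : (f %ₘ rootPoly R n).natDegree < n := by
  have h1 : rootPoly R n ≠ 1 := by
    intro h
    have := rootPoly_natDegree (R := R) n
    rw [h, Polynomial.natDegree_one] at this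
    omega
  exact lt_of_lt_of_eq (Polynomial.natDegree_modByMonic_lt _ (rootPoly_monic n) h1)
    (rootPoly_natDegree n)

theorem modByMonic_rootPoly_eq_self [Nontrivial R] {n : ℕ}
    {f : Polynomial (MvPolynomial (Fin n) R)} (hf : f.natDegree < n) :
    f %ₘ rootPoly R n = f := by
  rw [Polynomial.modByMonic_eq_self_iff (rootPoly_monic n)]
  apply Polynomial.degree_lt_degree
  rwa [rootPoly_natDegree]

/-- The value of `altDet` when all columns but the first agree with those of `A_δ`. -/
theorem altDet_eq_mul_topRemainder [Nontrivial R] {n : ℕ} (hn : 0 < n) (a : ℤ → R)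
    (α : Fin n → ℕ) (hα : ∀ j : Fin n, 0 < (j : ℕ) → α j = delta n j) :
    altDet a α = (Matrix.of fun i k : Fin n =>
        (X i : MvPolynomial (Fin n) R) ^ (Fin.rev k : ℕ)).det *
      topRemainder (liftFacPow n a (α ⟨0, hn⟩)) := by
  -- The columns hold the remainders in the basis T^(n-1), …, 1. All but the first are monic of
  -- degree n-1-j, so the matrix is lower triangular and only the first diagonal entry can differ
  -- from 1.
  let C : Matrix (Fin n) (Fin n) (MvPolynomial (Fin n) R) := Matrix.of fun k j =>
    (liftFacPow n a (α j) %ₘ rootPoly R n).coeff (Fin.rev k : ℕ)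
  have hself : ∀ j : Fin n, 0 < (j : ℕ) →
      liftFacPow n a (α j) %ₘ rootPoly R n = liftFacPow n a (n - 1 - j) := by
    intro j hj
    rw [hα j hj, delta]
    apply modByMonic_rootPoly_eq_self
    rw [liftFacPow_natDegree]
    omega
  have hC : C.det = topRemainder (liftFacPow n a (α ⟨0, hn⟩)) := by
    rw [Matrix.det_of_isLowerTriangular]
    · rw [Finset.prod_eq_single (⟨0, hn⟩ : Fin n)]
      · simp [C, topRemainder, Fin.val_rev]
      · intro j _ hj
        have hj' : 0 < (j : ℕ) := by
          rcases Nat.eq_zero_or_pos (j : ℕ) with h | h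
          · exact absurd (Fin.ext h) hj
          · exact h
        simp only [C, Matrix.of_apply]
        rw [hself j hj', show (Fin.rev j : ℕ) = (liftFacPow n a (n - 1 - j)).natDegree by
          rw [liftFacPow_natDegree, Fin.val_rev]; omega]
        exact liftFacPow_monic n a _
      · simp
    · intro i j hij
      have hij' : i < j := hij
      have hlt : (i : ℕ) < j := hij'
      simp only [C, Matrix.of_apply]
      rw [hself j (by omega)]
      apply Polynomial.coeff_eq_zero_of_natDegree_lt
      rw [liftFacPow_natDegree, Fin.val_rev]
      omega
  rw [← hC, ← Matrix.det_mul, altDet]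
  congr 1
  ext1 i j
  rw [Matrix.of_apply, Matrix.mul_apply, ← Polynomial.eval_map_algebraMap]
  change (liftFacPow n a (α j)).eval (X i) = _
  rw [← eval_modByMonic_rootPoly,
    Polynomial.eval_eq_sum_range' (natDegree_modByMonic_rootPoly_lt hn _),
    ← Fin.sum_univ_eq_sum_range (fun k => (liftFacPow n a (α j) %ₘ rootPoly R n).coeff k *
      (X i : MvPolynomial (Fin n) R) ^ k) n, ← Equiv.sum_comp Fin.revPerm]
  refine Finset.sum_congr rfl fun k _ => ?_
  simp only [C, Matrix.of_apply, Fin.revPerm_apply]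
  exact mul_comm _ _

theorem topRemainder_liftFacPow_of_lt [Nontrivial R] {n : ℕ} (a : ℤ → R) {r : ℕ}
    (hr : r + 1 < n) : topRemainder (liftFacPow n a r) = 0 := by
  rw [topRemainder, modByMonic_rootPoly_eq_self (by rw [liftFacPow_natDegree]; omega)]
  apply Polynomial.coeff_eq_zero_of_natDegree_lt
  rw [liftFacPow_natDegree]
  omega

theorem topRemainder_liftFacPow_self [Nontrivial R] {n : ℕ} (hn : 0 < n) (a : ℤ → R) :
    topRemainder (liftFacPow n a (n - 1)) = 1 := by
  rw [topRemainder, modByMonic_rootPoly_eq_self (by rw [liftFacPow_natDegree]; omega)]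
  have := liftFacPow_monic n a (n - 1)
  rwa [Polynomial.Monic, Polynomial.leadingCoeff, liftFacPow_natDegree] at this

/-! ### One-row partitions and complete polynomials -/

theorem rowLen_oneRow_zero (r : ℕ) : (oneRow r).rowLen 0 = r := by
  have := YoungDiagram.rowLen_ofRowLens (hw := (List.pairwise_singleton (· ≥ ·) r).sortedGE)
    (⟨0, by simp⟩ : Fin [r].length)
  exact this

theorem mem_oneRow {r : ℕ} {c : ℕ × ℕ} : c ∈ oneRow r ↔ c.1 = 0 ∧ c.2 < r := by
  rw [oneRow, YoungDiagram.mem_ofRowLens]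
  simp

theorem rowLen_oneRow_of_pos {r i : ℕ} (hi : 0 < i) : (oneRow r).rowLen i = 0 := by
  by_contra h
  have := mem_oneRow.1 (YoungDiagram.mem_iff_lt_rowLen.2 (Nat.pos_of_ne_zero h))
  exact hi.ne' this.1

theorem colLen_oneRow_le_one (r : ℕ) : (oneRow r).colLen 0 ≤ 1 := by
  by_contra! h
  have := mem_oneRow.1 (YoungDiagram.mem_iff_lt_colLen.2 h)
  exact one_ne_zero this.1

theorem colLen_oneRow_pos {r : ℕ} (hr : 0 < r) : 0 < (oneRow r).colLen 0 :=
  YoungDiagram.mem_iff_lt_colLen.1 (mem_oneRow.2 ⟨rfl, hr⟩)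

theorem schur_oneRow [Nontrivial R] {n : ℕ} (hn : 0 < n) (a : ℤ → R) (r : ℕ) :
    schur n a (oneRow r) = topRemainder (liftFacPow n a (r + (n - 1))) := by
  rw [schur, if_pos ((colLen_oneRow_le_one r).trans hn)]
  refine (existsUnique_quotient a _).unique (altQuotient_mul a _) ?_
  rw [altDet_eq_mul_topRemainder hn a (delta n) fun _ _ => rfl,
    altDet_eq_mul_topRemainder hn a _ fun j hj => by rw [rowLen_oneRow_of_pos hj, zero_add]]
  simp only [delta, rowLen_oneRow_zero, Nat.sub_zero, topRemainder_liftFacPow_self hn, mul_one]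
  exact mul_comm _ _

/-- The natural exponent k allows negative r > -n, where both sides vanish: the factorial power then
has degree below n-1. For n = 0 the modulus is 1, so every remainder is 0. -/
theorem complete_eq_topRemainder [Nontrivial R] {n : ℕ} (a : ℤ → R) {r : ℤ} {k : ℕ}
    (hk : r + n = k + 1) : complete n a r = topRemainder (liftFacPow n a k) := by
  rcases Nat.eq_zero_or_pos n with rfl | hn
  · have hr : 0 ≤ r := by omega
    rw [complete, if_pos hr, schur, if_neg]
    · simp [topRemainder, rootPoly]
    · have := colLen_oneRow_pos (r := r.toNat) (by omega)
      omega
  · by_cases hr : 0 ≤ r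
    · rw [complete, if_pos hr, schur_oneRow hn, show r.toNat + (n - 1) = k by omega]
    · rw [complete, if_neg hr, topRemainder_liftFacPow_of_lt a (by omega)]

/-- Only g modulo P matters, and it is a combination of 1, T, …, T^(n-1). This separates f from g as
a sum of n products. -/
theorem topRemainder_mul [Nontrivial R] {n : ℕ} (f g : Polynomial (MvPolynomial (Fin n) R)) :
    topRemainder (f * g) = ∑ s : Fin n, (g %ₘ rootPoly R n).coeff (s : ℕ) *
      topRemainder (f * Polynomial.X ^ (s : ℕ)) := by
  rcases Nat.eq_zero_or_pos n with rfl | hn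
  · simp [topRemainder, rootPoly]
  have hmod : (f * g) %ₘ rootPoly R n = (f * (g %ₘ rootPoly R n)) %ₘ rootPoly R n := by
    apply Polynomial.modByMonic_eq_of_dvd_sub (rootPoly_monic n)
    refine ⟨f * (g /ₘ rootPoly R n), ?_⟩
    linear_combination (-f) * Polynomial.modByMonic_add_div g (rootPoly R n)
  let L : Polynomial (MvPolynomial (Fin n) R) →ₗ[MvPolynomial (Fin n) R] MvPolynomial (Fin n) R :=
    (Polynomial.lcoeff _ (n - 1)).comp (Polynomial.modByMonicHom (rootPoly R n))
  have hL : ∀ p, topRemainder p = L p := fun p => rfl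
  rw [show topRemainder (f * g) = topRemainder (f * (g %ₘ rootPoly R n)) by
    rw [topRemainder, hmod, topRemainder]]
  simp only [hL]
  conv_lhs =>
    rw [(g %ₘ rootPoly R n).as_sum_range_C_mul_X_pow' (natDegree_modByMonic_rootPoly_lt hn g)]
  rw [Finset.mul_sum, map_sum, ← Fin.sum_univ_eq_sum_range
    (fun k => L (f * (Polynomial.C ((g %ₘ rootPoly R n).coeff k) * Polynomial.X ^ k))) n]
  refine Finset.sum_congr rfl fun s _ => ?_
  rw [mul_left_comm, ← Polynomial.smul_eq_C_mul, map_smul, smul_eq_mul]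

/-! ### The two vanishing cases -/

theorem skewSchur_eq_zero_of_colLen_lt (n : ℕ) (a : ℤ → R) (lam mu : YoungDiagram) (m : ℕ)
    (hmu : mu.colLen 0 ≤ m) (c : ℕ) (hc : lam.colLen c < mu.colLen c) :
    skewSchur n a lam mu m = 0 := by
  have hm : lam.colLen c < m := hc.trans_le ((mu.colLen_anti 0 c c.zero_le).trans hmu)
  let r : Fin m := ⟨lam.colLen c, hm⟩
  have h1 : lam.rowLen r ≤ c := by
    by_contra! h
    exact lt_irrefl _ (YoungDiagram.mem_iff_lt_colLen.1 (YoungDiagram.mem_iff_lt_rowLen.2 h))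
  have h2 : c < mu.rowLen r :=
    YoungDiagram.mem_iff_lt_rowLen.1 (YoungDiagram.mem_iff_lt_colLen.2 hc)
  -- For j ≤ r ≤ i one has λ_i ≤ c < μ_j, so the index of h is negative. The block sizes add up to m
  -- + 1.
  refine det_eq_zero_of_block_factors (κ := Fin 0) _ (Finset.Ici r) (Finset.Iic r)
    (fun _ _ => 0) (fun _ _ => 0) ?_ fun i hi j hj => ?_
  · rw [Fin.card_Ici, Fin.card_Iic, Fintype.card_fin, Fintype.card_fin]
    omega
  · have hi' : (r : ℕ) ≤ i := Fin.le_def.1 (Finset.mem_Ici.1 hi)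
    have hj' : (j : ℕ) ≤ r := Fin.le_def.1 (Finset.mem_Iic.1 hj)
    have := lam.rowLen_anti _ _ hi'
    have := mu.rowLen_anti _ _ hj'
    rw [Matrix.of_apply, complete, if_neg (by omega)]
    simp

theorem skewSchur_eq_zero_of_lt_colLen [Nontrivial R] (n : ℕ) (a : ℤ → R)
    (lam mu : YoungDiagram) (m : ℕ) (hlam : lam.colLen 0 ≤ m) (c : ℕ)
    (hc : mu.colLen c + n < lam.colLen c) : skewSchur n a lam mu m = 0 := by
  have hm : mu.colLen c + n < m := hc.trans_le ((lam.colLen_anti 0 c c.zero_le).trans hlam)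
  set p := mu.colLen c with hp
  let q : Fin m := ⟨p + n, hm⟩
  let p' : Fin m := ⟨p, by omega⟩
  -- The block has p+n+1 rows and m-p columns, together m+n+1. The power is cut where the shift
  -- reaches c-p; the bounds λ_i > c and μ_j ≤ c on the block make both exponents genuine natural
  -- differences.
  refine det_eq_zero_of_block_factors (κ := Fin n) _ (Finset.Iic q) (Finset.Ici p')
    (fun i s => (liftFacPow n (shift ((c : ℤ) - p) a) (lam.rowLen i + p + n - 1 - i - c) %ₘ
      rootPoly R n).coeff (s : ℕ))
    (fun s j => topRemainder (liftFacPow n (shift ((mu.rowLen j : ℤ) - (j : ℕ)) a)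
      (c + j - p - mu.rowLen j) * Polynomial.X ^ (s : ℕ))) ?_ fun i hi j hj => ?_
  · rw [Fin.card_Ici, Fin.card_Iic, Fintype.card_fin, Fintype.card_fin]
    simp only [q, p']
    omega
  · have hi' : (i : ℕ) ≤ p + n := Fin.le_def.1 (Finset.mem_Iic.1 hi)
    have hj' : p ≤ (j : ℕ) := Fin.le_def.1 (Finset.mem_Ici.1 hj)
    have h1 : c < lam.rowLen i := YoungDiagram.mem_iff_lt_rowLen.1
      (YoungDiagram.mem_iff_lt_colLen.2 (hi'.trans_lt hc))
    have h2 : mu.rowLen j ≤ c := by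
      by_contra! h
      have := YoungDiagram.mem_iff_lt_colLen.1 (YoungDiagram.mem_iff_lt_rowLen.2 h)
      omega
    rw [Matrix.of_apply, complete_eq_topRemainder _ (k := (c + j - p - mu.rowLen j) +
      (lam.rowLen i + p + n - 1 - i - c)) (by omega), liftFacPow_add, shift_shift,
      show ((c + j - p - mu.rowLen j : ℕ) : ℤ) + ((mu.rowLen j : ℤ) - (j : ℕ)) = (c : ℤ) - p by
        omega]
    exact topRemainder_mul _ _

end

end FactorialSchur

theorem mainTheorem3 {R : Type*} [CommRing R] (n : ℕ) (a : ℤ → R) (lam mu : YoungDiagram)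
    (m : ℕ) (hlam : lam.colLen 0 ≤ m) (hmu : mu.colLen 0 ≤ m)
    (h : ¬ ∀ i : ℕ, 0 ≤ (lam.colLen i : ℤ) - (mu.colLen i : ℤ) ∧
      (lam.colLen i : ℤ) - (mu.colLen i : ℤ) ≤ (n : ℤ)) :
    FactorialSchur.skewSchur n a lam mu m = 0 := by
  nontriviality R
  rw [not_forall] at h
  obtain ⟨c, hc⟩ := h
  rcases lt_or_ge (lam.colLen c) (mu.colLen c) with hlt | hle
  · exact FactorialSchur.skewSchur_eq_zero_of_colLen_lt n a lam mu m hmu c hlt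
  · exact FactorialSchur.skewSchur_eq_zero_of_lt_colLen n a lam mu m hlam c (by omega)
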